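/- All quantum systems are finite-dimensional, and a channel is a trace-preserving completely positive (TP-CP) map. **VIS protocols.** A VIS (verifier-initiated, three-round) protocol ${\cal V}$ with statements $r$ consists of the following data. For each $r$ there is a random classical witness $W_r$ with finitely many values (witnesses of different statements are independent), and a public system ${\cal H}_r$ held by the verifier, in a state $\rho_{r,w}$ when $W_r=w$. In step 1 the verifier applies a channel $Z_1:{\cal H}_r\to X_0\otimes V_1$ and sends the challenge $X_0$. In step 2 the prover, using the witness, applies a channel $Z_2$ to $X_0$, which produces the response $Y_0$ and classical variables kept in the prover's memory. In step 3 the verifier applies a channel $Z_3$ from $Y_0\otimes V_1$ to a bit $X_1$, where $1$ means accept. (The operations may depend on $r$.) **Concatenation.** ${\cal V}^1\otimes{\cal V}^2$, for two protocols with the same set of statements, has witnesses $(W_r^1,W_r^2)$ and public systems ${\cal H}^1_r\otimes{\cal H}^2_r$ that are independently prepared for the two factors; its operations are the tensor products; and the decision bit is $X_1=X_1^1X_1^2$. ${\cal V}^{\otimes l}$ is the $l$-fold concatenation of ${\cal V}$ (for $l=0$ the trivial protocol, which always accepts). **$\alpha$-completeness.** For every $r$ and every possible value $w$ of $W_r$,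 the honest verifier accepts the honest prover holding $w$ with probability at least $\alpha$. **$\beta$-soundness** consists of two conditions. - *Type 1.* For every $r$ and every possible value $w$ of $W_r$, the honest verifier accepts with probability at most $\beta$ a prover who follows the protocol with an incorrect witness $w'$ in place of $w$. Incorrect means $w'\ne w$; for a concatenation it means that the witness used for each of the concatenated protocols is incorrect. - *Type 2.* For every $r$ and every channel ${\cal E}:X_0\to Y_0$ that may depend on $r$ but not on $W_r$, the probability that the honest verifier accepts a prover who applies ${\cal E}$, averaged over $W_r$, is at most $\beta$. **Zero knowledge.** A (cheating) verifier uses, instead of $Z_1$ and $Z_3$, arbitrary channels ${\cal H}_r\to X_0\otimes S_1$ and $Y_0\otimes S_1\to S_2$ with finite-dimensional $S_1,S_2$ of its choice. It is *quantum specious* if, for every possible $w$, the honest prover's state (the received system $X_0$, together with $w$) is the same as with the honest verifier. It is *classical specious* if, for every possible $w$, the classical variables in the honest prover's memory have the same distribution as with the honest verifier. The protocol is zero-knowledge of type $\mathsf{HV}$, $\mathsf{QSV}$, $\mathsf{CSV}$ or $\mathsf{DV}$ if, for every $r$, when interacting with the honest prover, respectively the honest verifier, every quantum specious verifier, every classical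 specious verifier, or every verifier has at each step (after sending the challenge, after receiving the response, after its final operation) a state that does not depend on the value of $W_r$. A protocol is $QZKP^{t}_{\alpha,\beta}$ if it is $\alpha$-complete, $\beta$-sound (both types) and zero-knowledge of type $t$. **Theorem.** Let $t\in\{\mathsf{HV},\mathsf{QSV},\mathsf{CSV},\mathsf{DV}\}$ and $\alpha_1,\alpha_2,\alpha\ge 0$. If the VIS protocols ${\cal V}^1$ and ${\cal V}^2$ are $QZKP^{t}_{\alpha_1,\beta_1}$ and $QZKP^{t}_{\alpha_2,\beta_2}$, respectively, then ${\cal V}^1\otimes{\cal V}^2$ is $QZKP^{t}_{\alpha_1\alpha_2,\beta_1\beta_2}$. In particular, if ${\cal V}$ is $QZKP^{t}_{\alpha,\beta}$, then ${\cal V}^{\otimes l}$ is $QZKP^{t}_{\alpha^l,\beta^l}$ for every $l$. -/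

import Mathlib

open Matrix
open scoped Kronecker ComplexOrder

namespace QVIS

/-! ### Finite-dimensional quantum systems, states and channels

A quantum system (register) is given by a finite type `A` labelling its computational basis;
operators on it are complex matrices indexed by `A`. -/

/-- A density matrix on the register `A`. -/
structure DensityOp (A : Type) [Fintype A] where
  mat : Matrix A A ℂ
  posSemidef : mat.PosSemidef
  trace_eq_one : mat.trace = 1

/-- The superoperator `Φ ⊗ id` on `A ⊗ E`. -/
def ampl {A B : Type} (Φ : Matrix A A ℂ →ₗ[ℂ] Matrix B B ℂ) (E : Type) :
    Matrix (A × E) (A × E) ℂ →ₗ[ℂ] Matrix (B × E) (B × E) ℂ where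
  toFun M := Matrix.of fun p q => Φ (Matrix.of fun a a' => M (a, p.2) (a', q.2)) p.1 q.1
  map_add' M N := by
    ext p q
    have h : (Matrix.of fun a a' => (M + N) (a, p.2) (a', q.2))
        = (Matrix.of fun a a' => M (a, p.2) (a', q.2))
          + (Matrix.of fun a a' => N (a, p.2) (a', q.2)) := by
      ext a a'; simp
    simp only [Matrix.of_apply, Matrix.add_apply] at h ⊢
    rw [h, map_add, Matrix.add_apply]
  map_smul' c M := by
    ext p q
    have h : (Matrix.of fun a a' => (c • M) (a, p.2) (a', q.2))
        = c • (Matrix.of fun a a' => M (a, p.2) (a', q.2)) := by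
      ext a a'; simp
    simp only [Matrix.of_apply, Matrix.smul_apply, RingHom.id_apply] at h ⊢
    rw [h, map_smul, Matrix.smul_apply]

/-- Complete positivity: `Φ ⊗ id` preserves positivity for every finite-dimensional ancilla. -/
def IsCP {A B : Type} (Φ : Matrix A A ℂ →ₗ[ℂ] Matrix B B ℂ) : Prop :=
  ∀ (E : Type) [Fintype E] (M : Matrix (A × E) (A × E) ℂ),
    M.PosSemidef → (ampl Φ E M).PosSemidef

/-- A quantum operation: a trace-preserving completely positive map. -/
structure Channel (A B : Type) [Fintype A] [Fintype B] where
  map : Matrix A A ℂ →ₗ[ℂ] Matrix B B ℂ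
  cp : IsCP map
  tp : ∀ M, (map M).trace = M.trace

/-- Partial trace over the first tensor factor. -/
def traceFst {A B : Type} [Fintype A] (M : Matrix (A × B) (A × B) ℂ) : Matrix B B ℂ :=
  Matrix.of fun b b' => ∑ a, M (a, b) (a, b')

/-- Partial trace over the second tensor factor. -/
def traceSnd {A B : Type} [Fintype B] (M : Matrix (A × B) (A × B) ℂ) : Matrix A A ℂ :=
  Matrix.of fun a a' => ∑ b, M (a, b) (a', b)

/-- The tensor product `Φ ⊗ Ψ` of two superoperators. -/
def tensorMap {A B A' B' : Type} (Φ : Matrix A A ℂ →ₗ[ℂ] Matrix B B ℂ)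
    (Ψ : Matrix A' A' ℂ →ₗ[ℂ] Matrix B' B' ℂ) :
    Matrix (A × A') (A × A') ℂ →ₗ[ℂ] Matrix (B × B') (B × B') ℂ where
  toFun M := Matrix.of fun p q =>
    Φ (Matrix.of fun a a' => Ψ (Matrix.of fun c c' => M (a, c) (a', c')) p.2 q.2) p.1 q.1
  map_add' M N := by
    ext p q
    have h : (Matrix.of fun a a' => Ψ (Matrix.of fun c c' => (M + N) (a, c) (a', c')) p.2 q.2)
        = (Matrix.of fun a a' => Ψ (Matrix.of fun c c' => M (a, c) (a', c')) p.2 q.2)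
          + (Matrix.of fun a a' => Ψ (Matrix.of fun c c' => N (a, c) (a', c')) p.2 q.2) := by
      ext a a'
      have h' : (Matrix.of fun c c' => (M + N) (a, c) (a', c'))
          = (Matrix.of fun c c' => M (a, c) (a', c'))
            + (Matrix.of fun c c' => N (a, c) (a', c')) := by
        ext c c'; simp
      rw [Matrix.of_apply, h', map_add]
      rfl
    simp only [Matrix.of_apply]
    rw [h, map_add]
    rfl
  map_smul' k M := by
    ext p q
    have h : (Matrix.of fun a a' => Ψ (Matrix.of fun c c' => (k • M) (a, c) (a', c')) p.2 q.2)
        = k • (Matrix.of fun a a' => Ψ (Matrix.of fun c c' => M (a, c) (a', c')) p.2 q.2) := by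
      ext a a'
      have h' : (Matrix.of fun c c' => (k • M) (a, c) (a', c'))
          = k • (Matrix.of fun c c' => M (a, c) (a', c')) := by
        ext c c'; simp
      rw [Matrix.of_apply, h', map_smul]
      rfl
    simp only [Matrix.of_apply]
    rw [h, map_smul]
    rfl

theorem isCP_tensorMap {A B A' B' : Type} [Fintype A] [Fintype B']
    {Φ : Matrix A A ℂ →ₗ[ℂ] Matrix B B ℂ} {Ψ : Matrix A' A' ℂ →ₗ[ℂ] Matrix B' B' ℂ}
    (hΦ : IsCP Φ) (hΨ : IsCP Ψ) : IsCP (tensorMap Φ Ψ) := by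
  intro E _ M hM
  have h1 := hΨ (A × E) (M.submatrix (fun p => ((p.2.1, p.1), p.2.2))
    (fun p => ((p.2.1, p.1), p.2.2))) (hM.submatrix _)
  have h2 := hΦ (B' × E) (Matrix.submatrix _ (fun p : A × (B' × E) => (p.2.1, (p.1, p.2.2)))
    (fun p : A × (B' × E) => (p.2.1, (p.1, p.2.2)))) (h1.submatrix _)
  exact h2.submatrix (fun p : (B × B') × E => (p.1.1, (p.1.2, p.2)))

/-- The tensor product of two channels. -/
def Channel.tensor {A B A' B' : Type} [Fintype A] [Fintype B] [Fintype A'] [Fintype B']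
    (Φ : Channel A B) (Ψ : Channel A' B') : Channel (A × A') (B × B') where
  map := tensorMap Φ.map Ψ.map
  cp := isCP_tensorMap Φ.cp Ψ.cp
  tp M := by
    have hsum : ∑ b' : B', (Matrix.of fun a a' =>
          Ψ.map (Matrix.of fun c c' => M (a, c) (a', c')) b' b')
        = Matrix.of fun a a' => ∑ c, M (a, c) (a', c) := by
      ext a a'
      have := Ψ.tp (Matrix.of fun c c' => M (a, c) (a', c'))
      simp only [Matrix.trace, Matrix.diag_apply, Matrix.of_apply] at this
      rw [Matrix.sum_apply]
      simpa using this
    have hΦ := Φ.tp (Matrix.of fun a a' => ∑ c, M (a, c) (a', c))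
    rw [← hsum, map_sum] at hΦ
    rw [hsum] at hΦ
    simp only [Matrix.trace, Matrix.diag_apply, Matrix.of_apply, Matrix.sum_apply] at hΦ
    simp only [Matrix.trace, Matrix.diag_apply, Fintype.sum_prod_type]
    exact hΦ

/-- Relabelling of the input and output bases of a channel. -/
def Channel.reindex {A B A' B' : Type} [Fintype A] [Fintype B] [Fintype A'] [Fintype B']
    (e : A' ≃ A) (f : B ≃ B') (Φ : Channel A B) : Channel A' B' where
  map :=
    { toFun := fun M => (Φ.map (M.submatrix e.symm e.symm)).submatrix f.symm f.symm
      map_add' := fun M N => by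
        rw [Matrix.submatrix_add]
        simp only [Pi.add_apply, map_add, Matrix.submatrix_add]
      map_smul' := fun c M => by
        rw [Matrix.submatrix_smul]
        simp only [Pi.smul_apply, map_smul, Matrix.submatrix_smul, RingHom.id_apply] }
  cp := by
    intro E _ M hM
    have h := Φ.cp E (M.submatrix (fun p => (e.symm p.1, p.2)) (fun p => (e.symm p.1, p.2)))
      (hM.submatrix _)
    exact h.submatrix (fun p : B' × E => (f.symm p.1, p.2))
  tp M := by
    have h := Φ.tp (M.submatrix e.symm e.symm)
    simp only [Matrix.trace, Matrix.diag_apply, Matrix.submatrix_apply] at h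
    simp only [Matrix.trace, Matrix.diag_apply, LinearMap.coe_mk, AddHom.coe_mk,
      Matrix.submatrix_apply]
    rw [Equiv.sum_comp f.symm (fun b => Φ.map (M.submatrix e.symm e.symm) b b), h]
    exact Equiv.sum_comp e.symm (fun a => M a a)

/-- Sequential composition: first `Φ`, then `Ψ`. -/
def Channel.andThen {A B C : Type} [Fintype A] [Fintype B] [Fintype C]
    (Φ : Channel A B) (Ψ : Channel B C) : Channel A C where
  map := Ψ.map ∘ₗ Φ.map
  cp := fun E _ M hM => Ψ.cp E _ (Φ.cp E M hM)
  tp M := by rw [LinearMap.comp_apply, Ψ.tp, Φ.tp]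

/-- Measure in the computational basis and record the value of the function `f` of the outcome. -/
def Channel.ofFun {A B : Type} [Fintype A] [Fintype B] [DecidableEq B] (f : A → B) :
    Channel A B where
  map :=
    { toFun := fun M => Matrix.diagonal fun b => ∑ a, if f a = b then M a a else 0
      map_add' := fun M N => by
        rw [Matrix.diagonal_add]
        congr 1
        ext b
        rw [← Finset.sum_add_distrib]
        refine Finset.sum_congr rfl fun a _ => ?_
        split_ifs <;> simp
      map_smul' := fun c M => by
        rw [RingHom.id_apply, ← Matrix.diagonal_smul]
        congr 1
        ext b
        rw [Pi.smul_apply, Finset.smul_sum]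
        refine Finset.sum_congr rfl fun a _ => ?_
        split_ifs <;> simp }
  cp := by
    intro E _ M hM
    have key : ∀ a : A, (((Matrix.diagonal fun b : B => if f a = b then (1 : ℂ) else 0)) ⊗ₖ
        (M.submatrix (fun e : E => (a, e)) (fun e : E => (a, e)))).PosSemidef := by
      intro a
      refine Matrix.PosSemidef.kronecker (Matrix.PosSemidef.diagonal ?_) (hM.submatrix _)
      intro b
      show (0 : ℂ) ≤ if f a = b then (1 : ℂ) else 0
      split_ifs <;> simp
    have hs := Matrix.posSemidef_sum Finset.univ (fun a _ => key a)
    convert hs using 1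
    ext p q
    simp only [ampl, LinearMap.coe_mk, AddHom.coe_mk, Matrix.of_apply, Matrix.sum_apply,
      Matrix.kroneckerMap_apply, Matrix.submatrix_apply, Matrix.diagonal_apply]
    by_cases h : p.1 = q.1
    · simp [h]
    · simp [h]
  tp M := by
    simp only [Matrix.trace, Matrix.diag_apply, LinearMap.coe_mk, AddHom.coe_mk,
      Matrix.diagonal_apply_eq]
    rw [Finset.sum_comm]
    simp

/-- The tensor product of two density matrices. -/
def DensityOp.tensor {A B : Type} [Fintype A] [Fintype B] (ρ : DensityOp A) (σ : DensityOp B) :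
    DensityOp (A × B) where
  mat := ρ.mat ⊗ₖ σ.mat
  posSemidef := ρ.posSemidef.kronecker σ.posSemidef
  trace_eq_one := by rw [Matrix.trace_kronecker, ρ.trace_eq_one, σ.trace_eq_one, one_mul]

/-! ### VIS protocols -/

/-- A verifier-initiated three-round protocol with statements `r : R`.

* The witness of statement `r` is a classical random variable with law `prior r`. It is a family
  of keys, one for each of the component protocols `k : K`; a protocol that is not a concatenation
  has a single component. Witnesses of different statements are independent.
* `pub r w` is the state of the public system `H r` held by the verifier when the witness is `w`.
* `Z₁` maps the verifier's register `H r` to the challenge `X₀` and the verifier's memory `V₁`.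
* `Z₂` is applied by the prover, who holds `(r, w)`, to the challenge. It yields the classical
  variables `P₁` kept in the prover's memory and the response `Y₀`.
* `Z₃` maps the response and the verifier's memory to the decision bit (`true` means accept). -/
structure VIS (R : Type*) where
  K : Type
  [fintypeK : Fintype K]
  [decEqK : DecidableEq K]
  [nonemptyK : Nonempty K]
  Key : R → K → Type
  [fintypeKey : ∀ r k, Fintype (Key r k)]
  prior : (r : R) → (∀ k, Key r k) → ℝ
  prior_nonneg : ∀ (r : R) (w : ∀ k, Key r k), 0 ≤ prior r w
  prior_sum : ∀ r : R, ∑ w : ∀ k, Key r k, prior r w = 1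
  H : R → Type
  [fintypeH : ∀ r, Fintype (H r)]
  V₁ : Type
  [fintypeV₁ : Fintype V₁]
  X₀ : Type
  [fintypeX₀ : Fintype X₀]
  P₁ : Type
  [fintypeP₁ : Fintype P₁]
  Y₀ : Type
  [fintypeY₀ : Fintype Y₀]
  pub : ∀ r : R, (∀ k, Key r k) → DensityOp (H r)
  Z₁ : ∀ r : R, Channel (H r) (X₀ × V₁)
  Z₂ : ∀ r : R, (∀ k, Key r k) → Channel X₀ (P₁ × Y₀)
  Z₃ : R → Channel (Y₀ × V₁) Bool

attribute [instance] VIS.fintypeK VIS.decEqK VIS.nonemptyK VIS.fintypeKey VIS.fintypeH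
  VIS.fintypeV₁ VIS.fintypeX₀ VIS.fintypeP₁ VIS.fintypeY₀

namespace VIS

variable {R : Type*}

/-- The witnesses of the statement `r`. -/
abbrev Witness (V : VIS R) (r : R) : Type := ∀ k, V.Key r k

/-- The honest response to the challenge, computed with the witness `w`: apply `Z₂` and discard
the prover's memory. -/
def respond (V : VIS R) (r : R) (w : V.Witness r) :
    Matrix V.X₀ V.X₀ ℂ →ₗ[ℂ] Matrix V.Y₀ V.Y₀ ℂ where
  toFun M := traceFst ((V.Z₂ r w).map M)
  map_add' M N := by
    ext y y'
    simp [traceFst, Finset.sum_add_distrib]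
  map_smul' c M := by
    ext y y'
    simp [traceFst, Finset.mul_sum]

/-- The probability that the honest verifier accepts, when the statement is `r`, its witness is
`w`, and the prover answers the challenge by the superoperator `F`. -/
noncomputable def acceptProb (V : VIS R) (r : R) (w : V.Witness r)
    (F : Matrix V.X₀ V.X₀ ℂ →ₗ[ℂ] Matrix V.Y₀ V.Y₀ ℂ) : ℝ :=
  ((V.Z₃ r).map (ampl F V.V₁ ((V.Z₁ r).map (V.pub r w).mat)) true true).re

/-- `α`-completeness: on the correct input `(r, W_r)`, the honest verifier accepts the honest
prover with probability at least `α`. -/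
def Complete (V : VIS R) (α : ℝ) : Prop :=
  ∀ r (w : V.Witness r), 0 < V.prior r w → α ≤ V.acceptProb r w (V.respond r w)

/-- `w'` is an incorrect witness in place of `w`: every key of `w'` is wrong. With one component
this says `w' ≠ w`. -/
def Incorrect (V : VIS R) {r : R} (w' w : V.Witness r) : Prop := ∀ k, w' k ≠ w k

/-- `β`-soundness of type 1, against an honest prover with an incorrect witness. -/
def SoundType1 (V : VIS R) (β : ℝ) : Prop :=
  ∀ r (w w' : V.Witness r), 0 < V.prior r w → V.Incorrect w' w →
    V.acceptProb r w (V.respond r w') ≤ β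

/-- `β`-soundness of type 2, against a prover who applies an arbitrary quantum operation that
may depend on `r` but not on the random witness `W_r`. -/
def SoundType2 (V : VIS R) (β : ℝ) : Prop :=
  ∀ r (F : Channel V.X₀ V.Y₀), ∑ w, V.prior r w * V.acceptProb r w F.map ≤ β

/-- The behaviour of a (possibly dishonest) verifier on statement `r`, with a private register
`S₁` of arbitrary finite dimension and a final register `S₂`. The verifier holds the public system
but does not know the witness. -/
structure Verifier (V : VIS R) (r : R) where
  S₁ : Type
  [fintypeS₁ : Fintype S₁]
  S₂ : Type
  [fintypeS₂ : Fintype S₂]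
  A₁ : Channel (V.H r) (V.X₀ × S₁)
  A₃ : Channel (V.Y₀ × S₁) S₂

attribute [instance] Verifier.fintypeS₁ Verifier.fintypeS₂

/-- The honest verifier. -/
def honestVerifier (V : VIS R) (r : R) : V.Verifier r where
  S₁ := V.V₁
  S₂ := Bool
  A₁ := V.Z₁ r
  A₃ := V.Z₃ r

namespace Verifier

variable {V : VIS R} {r : R}

/-- Joint state of the challenge and the verifier's register after the verifier's first step. -/
def challenge (A : V.Verifier r) (w : V.Witness r) :
    Matrix (V.X₀ × A.S₁) (V.X₀ × A.S₁) ℂ :=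
  A.A₁.map (V.pub r w).mat

/-- Joint state of the prover's memory, the response and the verifier's register after the honest
prover's step. -/
def afterResponse (A : V.Verifier r) (w : V.Witness r) :
    Matrix ((V.P₁ × V.Y₀) × A.S₁) ((V.P₁ × V.Y₀) × A.S₁) ℂ :=
  ampl (V.Z₂ r w).map A.S₁ (A.challenge w)

/-- The verifier's state after sending the challenge. -/
def view₁ (A : V.Verifier r) (w : V.Witness r) : Matrix A.S₁ A.S₁ ℂ :=
  traceFst (A.challenge w)

/-- The verifier's state after receiving the response. -/
def view₂ (A : V.Verifier r) (w : V.Witness r) : Matrix (V.Y₀ × A.S₁) (V.Y₀ × A.S₁) ℂ :=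
  traceFst ((A.afterResponse w).submatrix (Equiv.prodAssoc V.P₁ V.Y₀ A.S₁).symm
    (Equiv.prodAssoc V.P₁ V.Y₀ A.S₁).symm)

/-- The verifier's state after the final operation. -/
def view₃ (A : V.Verifier r) (w : V.Witness r) : Matrix A.S₂ A.S₂ ℂ :=
  A.A₃.map (A.view₂ w)

/-- The quantum system received by the honest prover (whose register `P₀` holds `w`). -/
def proverState (A : V.Verifier r) (w : V.Witness r) : Matrix V.X₀ V.X₀ ℂ :=
  traceSnd (A.challenge w)

/-- The distribution of the classical variables in the honest prover's memory. -/
noncomputable def proverMemory (A : V.Verifier r) (w : V.Witness r) (p : V.P₁) : ℝ :=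
  (∑ y, ∑ s, A.afterResponse w ((p, y), s) ((p, y), s)).re

/-- Quantum specious: the joint state of the honest prover's registers (the witness in `P₀` and
the challenge in `X₀`) is the same as with the honest verifier. -/
def QuantumSpecious (A : V.Verifier r) : Prop :=
  ∀ w, 0 < V.prior r w → A.proverState w = (V.honestVerifier r).proverState w

/-- Classical specious: the classical variables in the honest prover's memory (with the witness)
have the same distribution as with the honest verifier. -/
def ClassicalSpecious (A : V.Verifier r) : Prop :=
  ∀ w, 0 < V.prior r w → A.proverMemory w = (V.honestVerifier r).proverMemory w

/-- The verifier's state at each step of the interaction with the honest prover is independent of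
the witness. -/
def LearnsNothing (A : V.Verifier r) : Prop :=
  ∀ w w', 0 < V.prior r w → 0 < V.prior r w' →
    A.view₁ w = A.view₁ w' ∧ A.view₂ w = A.view₂ w' ∧ A.view₃ w = A.view₃ w'

end Verifier

end VIS

/-- Honest, quantum specious, classical specious and dishonest verifiers. -/
inductive VerifierType
  | HV
  | QSV
  | CSV
  | DV

namespace VIS

variable {R : Type*}

/-- The zero-knowledge property against verifiers of type `t`. -/
def ZeroKnowledge (V : VIS R) : VerifierType → Prop
  | .HV => ∀ r, (V.honestVerifier r).LearnsNothing
  | .QSV => ∀ r (A : V.Verifier r), A.QuantumSpecious → A.LearnsNothing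
  | .CSV => ∀ r (A : V.Verifier r), A.ClassicalSpecious → A.LearnsNothing
  | .DV => ∀ r (A : V.Verifier r), A.LearnsNothing

/-- `QZKP^t_{α,β}`. -/
def IsQZKP (V : VIS R) (t : VerifierType) (α β : ℝ) : Prop :=
  V.Complete α ∧ V.SoundType1 β ∧ V.SoundType2 β ∧ V.ZeroKnowledge t

/-! ### Concatenation -/

/-- The key types of a concatenation: the components are those of both protocols. -/
def SumKey {K K' : Type} (A : K → Type) (B : K' → Type) : K ⊕ K' → Type
  | .inl k => A k
  | .inr k => B k

instance {K K' : Type} (A : K → Type) (B : K' → Type) [∀ k, Fintype (A k)]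
    [∀ k, Fintype (B k)] : ∀ k, Fintype (SumKey A B k)
  | .inl k => inferInstanceAs (Fintype (A k))
  | .inr k => inferInstanceAs (Fintype (B k))

/-- A witness of a concatenation is a pair of witnesses. -/
def splitKeys {K K' : Type} (A : K → Type) (B : K' → Type) :
    (∀ k, SumKey A B k) ≃ (∀ k, A k) × (∀ k, B k) where
  toFun w := (fun k => w (.inl k), fun k => w (.inr k))
  invFun p
    | .inl k => p.1 k
    | .inr k => p.2 k
  left_inv w := by
    ext k
    cases k <;> rfl
  right_inv _ := rfl

/-- The concatenation `V ⊗ V'`: the witnesses and the public systems of the same statement are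
independently prepared, all operations are tensor products, and the verifier accepts if and only
if both decision bits are `1`. -/
def concat (V V' : VIS R) : VIS R where
  K := V.K ⊕ V'.K
  Key r := SumKey (V.Key r) (V'.Key r)
  prior r w := V.prior r (splitKeys _ _ w).1 * V'.prior r (splitKeys _ _ w).2
  prior_nonneg r w := mul_nonneg (V.prior_nonneg r _) (V'.prior_nonneg r _)
  prior_sum r := by
    rw [Equiv.sum_comp (splitKeys (V.Key r) (V'.Key r))
      (fun p => V.prior r p.1 * V'.prior r p.2), Fintype.sum_prod_type]
    simp only
    rw [← Finset.sum_mul_sum, V.prior_sum, V'.prior_sum, one_mul]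
  H r := V.H r × V'.H r
  V₁ := V.V₁ × V'.V₁
  X₀ := V.X₀ × V'.X₀
  P₁ := V.P₁ × V'.P₁
  Y₀ := V.Y₀ × V'.Y₀
  pub r w := (V.pub r (splitKeys _ _ w).1).tensor (V'.pub r (splitKeys _ _ w).2)
  Z₁ r := ((V.Z₁ r).tensor (V'.Z₁ r)).reindex (Equiv.refl _)
    (Equiv.prodProdProdComm V.X₀ V.V₁ V'.X₀ V'.V₁)
  Z₂ r w := ((V.Z₂ r (splitKeys _ _ w).1).tensor (V'.Z₂ r (splitKeys _ _ w).2)).reindex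
    (Equiv.refl _) (Equiv.prodProdProdComm V.P₁ V.Y₀ V'.P₁ V'.Y₀)
  Z₃ r := (((V.Z₃ r).tensor (V'.Z₃ r)).reindex
    (Equiv.prodProdProdComm V.Y₀ V'.Y₀ V.V₁ V'.V₁) (Equiv.refl _)).andThen
      (Channel.ofFun fun x => x.1 && x.2)

/-- The empty concatenation: one-dimensional systems, a single witness, always accept. -/
def trivial : VIS R where
  K := Unit
  Key _ _ := Unit
  prior _ _ := 1
  prior_nonneg _ _ := zero_le_one
  prior_sum _ := by simp
  H _ := Unit
  V₁ := Unit
  X₀ := Unit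
  P₁ := Unit
  Y₀ := Unit
  pub _ _ := ⟨1, Matrix.PosSemidef.one, by simp⟩
  Z₁ _ := Channel.ofFun fun _ => ((), ())
  Z₂ _ _ := Channel.ofFun fun _ => ((), ())
  Z₃ _ := Channel.ofFun fun _ => true

/-- The `l`-fold concatenation `V^{⊗ l}`. -/
def pow (V : VIS R) : ℕ → VIS R
  | 0 => trivial
  | 1 => V
  | l + 2 => (V.pow (l + 1)).concat V

end VIS

end QVIS

/-! In a concatenation everything honest is a tensor product, so the acceptance probabilities of
provers who follow the protocol, with right or wrong witnesses, multiply (`acceptProb_concat`). This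
gives completeness and type 1 soundness.

For type 2 soundness the prover may act jointly on both challenges. By linearity and independence of
the witnesses, the prover's channel `F` receives a product of averaged states and is followed by a
product test. Fixing the second state and conditioning on the second test accepting leaves a
completely positive map on the first challenge (`conditionalMap`). Its trace on a state `M` is the
acceptance probability in the second protocol of the channel "adjoin `M`, apply `F`, discard the
first response", hence is at most `β'`. A completely positive map that multiplies traces by at most
`c > 0` is dominated by `c` times a channel (`IsCP.exists_channel`), and a channel passes the first
test with probability at most `β`. Letting `c` decrease to `β'` gives `β * β'`
(`re_product_test_le`).

Zero knowledge is a hybrid argument: for fixed `w'`, a verifier of the concatenation yields a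
verifier `left w'` of the first protocol, which prepares the second public system itself and stores
the second challenge. The original view is a processing of the view of `left w'`, so the first
witness can be changed without effect, and then the second by symmetry. Speciousness is inherited
because honest challenges are products. Honest verifiers are treated separately, by factoring their
views. -/

namespace QVIS

/-! ### Positivity, traces and domination by channels. -/

section Superoperators

variable {A B A' B' E E' : Type}

theorem posSemidef_traceFst [Fintype A] {M : Matrix (A × B) (A × B) ℂ}
    (hM : M.PosSemidef) : (traceFst M).PosSemidef := by
  have h : traceFst M = ∑ a, M.submatrix (fun b => (a, b)) (fun b => (a, b)) := by
    ext b b'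
    simp [traceFst, Matrix.sum_apply]
  rw [h]
  exact Matrix.posSemidef_sum _ fun a _ => hM.submatrix _

theorem IsCP.posSemidef {Φ : Matrix A A ℂ →ₗ[ℂ] Matrix B B ℂ} (hΦ : IsCP Φ)
    {M : Matrix A A ℂ} (hM : M.PosSemidef) : (Φ M).PosSemidef :=
  (hΦ Unit (M.submatrix Prod.fst Prod.fst) (hM.submatrix _)).submatrix fun b => (b, ())

theorem trace_ampl [Fintype A] [Fintype B] [Fintype E] {Φ : Matrix A A ℂ →ₗ[ℂ] Matrix B B ℂ}
    (hΦ : ∀ M, (Φ M).trace = M.trace) (M : Matrix (A × E) (A × E) ℂ) :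
    (ampl Φ E M).trace = M.trace := by
  simp only [Matrix.trace, Matrix.diag_apply, Fintype.sum_prod_type_right]
  exact Finset.sum_congr rfl fun e _ => hΦ (Matrix.of fun a a' => M (a, e) (a', e))

/-- The tensor product of two bipartite operators, with the first and the second systems grouped. -/
abbrev regroup (M : Matrix (A × E) (A × E) ℂ) (N : Matrix (A' × E') (A' × E') ℂ) :
    Matrix ((A × A') × (E × E')) ((A × A') × (E × E')) ℂ :=
  (M ⊗ₖ N).submatrix (Equiv.prodProdProdComm A E A' E').symm
    (Equiv.prodProdProdComm A E A' E').symm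

theorem tensorMap_kronecker (Φ : Matrix A A ℂ →ₗ[ℂ] Matrix B B ℂ)
    (Ψ : Matrix A' A' ℂ →ₗ[ℂ] Matrix B' B' ℂ) (M : Matrix A A ℂ) (N : Matrix A' A' ℂ) :
    tensorMap Φ Ψ (M ⊗ₖ N) = Φ M ⊗ₖ Ψ N := by
  ext p q
  have h : ∀ a a', (Matrix.of fun c c' => (M ⊗ₖ N) (a, c) (a', c')) = M a a' • N := by
    intro a a'; ext c c'; simp
  simp only [tensorMap, LinearMap.coe_mk, AddHom.coe_mk, Matrix.of_apply, h, map_smul]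
  have h' : (Matrix.of fun a a' => (M a a' • Ψ N) p.2 q.2) = Ψ N p.2 q.2 • M := by
    ext a a'; simp [mul_comm]
  rw [h', map_smul]
  simp [mul_comm]

theorem ampl_regroup {Θ : Matrix (A × A') (A × A') ℂ →ₗ[ℂ] Matrix (B × B') (B × B') ℂ}
    {Φ : Matrix A A ℂ →ₗ[ℂ] Matrix B B ℂ} {Ψ : Matrix A' A' ℂ →ₗ[ℂ] Matrix B' B' ℂ}
    (hΘ : ∀ M N, Θ (M ⊗ₖ N) = Φ M ⊗ₖ Ψ N)
    (M : Matrix (A × E) (A × E) ℂ) (N : Matrix (A' × E') (A' × E') ℂ) :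
    ampl Θ (E × E') (regroup M N) = regroup (ampl Φ E M) (ampl Ψ E' N) := by
  ext p q
  exact congrFun₂ (hΘ (Matrix.of fun a a' => M (a, p.2.1) (a', q.2.1))
    (Matrix.of fun a a' => N (a, p.2.2) (a', q.2.2))) p.1 q.1

theorem traceFst_regroup [Fintype A] [Fintype A']
    (M : Matrix (A × E) (A × E) ℂ) (N : Matrix (A' × E') (A' × E') ℂ) :
    traceFst (regroup M N) = traceFst M ⊗ₖ traceFst N := by
  ext p q
  simp only [traceFst, regroup, Matrix.of_apply, Matrix.submatrix_apply,
    Matrix.kroneckerMap_apply, Fintype.sum_prod_type, Finset.sum_mul_sum]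
  rfl

theorem traceSnd_regroup [Fintype E] [Fintype E']
    (M : Matrix (A × E) (A × E) ℂ) (N : Matrix (A' × E') (A' × E') ℂ) :
    traceSnd (regroup M N) = traceSnd M ⊗ₖ traceSnd N := by
  ext p q
  simp only [traceSnd, regroup, Matrix.of_apply, Matrix.submatrix_apply,
    Matrix.kroneckerMap_apply, Fintype.sum_prod_type, Finset.sum_mul_sum]
  rfl

theorem traceFst_kronecker [Fintype A] (M : Matrix A A ℂ) (N : Matrix B B ℂ) :
    traceFst (M ⊗ₖ N) = M.trace • N := by
  ext b b'
  simp [traceFst, Matrix.trace, Finset.sum_mul]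

theorem traceSnd_kronecker [Fintype B] (M : Matrix A A ℂ) (N : Matrix B B ℂ) :
    traceSnd (M ⊗ₖ N) = N.trace • M := by
  ext b b'
  simp [traceSnd, Matrix.trace, Finset.mul_sum, mul_comm]

theorem trace_traceFst [Fintype A] [Fintype B] (M : Matrix (A × B) (A × B) ℂ) :
    (traceFst M).trace = M.trace := by
  simp [traceFst, Matrix.trace, Fintype.sum_prod_type_right]

theorem trace_traceSnd [Fintype A] [Fintype B] (M : Matrix (A × B) (A × B) ℂ) :
    (traceSnd M).trace = M.trace := by
  simp [traceSnd, Matrix.trace, Fintype.sum_prod_type]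

/-- Pairing with a vector of `E` reduces the claim to `hb` for a positive operator on `A` alone. In
`IsCP.exists_channel` this makes the correction term completely positive. -/
theorem trace_compl_posSemidef [Fintype A] [Fintype B] [Fintype E]
    {Φ : Matrix A A ℂ →ₗ[ℂ] Matrix B B ℂ} (hΦ : IsCP Φ) {b : ℝ}
    (hb : ∀ M : Matrix A A ℂ, M.PosSemidef → (Φ M).trace ≤ b * M.trace)
    {M : Matrix (A × E) (A × E) ℂ} (hM : M.PosSemidef) :
    ((b : ℂ) • traceFst M - traceFst (ampl Φ E M)).PosSemidef := by
  classical
  refine PosSemidef.of_dotProduct_mulVec_nonneg ?_ fun x => ?_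
  · refine IsHermitian.sub ?_ (posSemidef_traceFst (hΦ E M hM)).isHermitian
    have h := (posSemidef_traceFst hM).isHermitian
    rw [IsHermitian, Matrix.conjTranspose_smul, h.eq]
    simp
  -- `C` is the identity of `A` tensored with the column `x`; the bound `hb` at `Cᴴ * M * C` is
  -- exactly nonnegativity of the quadratic form at `x`.
  · set C : Matrix (A × E) A ℂ := Matrix.of fun p a => if p.1 = a then x p.2 else 0 with hC
    have hN := hM.conjTranspose_mul_mul_same C
    have hN' : Cᴴ * M * C = ∑ e, ∑ e', (star (x e) * x e') •
        (Matrix.of fun a a' => M (a, e) (a', e')) := by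
      ext a a'
      simp only [Matrix.mul_apply, Matrix.conjTranspose_apply, Fintype.sum_prod_type, hC,
        Matrix.of_apply, Matrix.sum_apply, Matrix.smul_apply, smul_eq_mul, Finset.sum_mul]
      rw [Finset.sum_comm]
      simp only [apply_ite star, star_zero, ite_mul, zero_mul, mul_ite, mul_zero,
        Finset.sum_const_zero, Finset.sum_ite_irrel,
        Finset.sum_ite_eq', Finset.mem_univ, if_true]
      simp
      rw [Finset.sum_comm]
      refine Finset.sum_congr rfl fun e _ => Finset.sum_congr rfl fun e' _ => by ring
    have key := hb _ hN
    rw [← sub_nonneg] at key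
    convert key using 1
    rw [hN']
    simp only [map_sum, map_smul, Matrix.trace_sum, Matrix.trace_smul, smul_eq_mul,
      Finset.mul_sum, ← Finset.sum_sub_distrib, dotProduct, mulVec]
    refine Finset.sum_congr rfl fun e _ => Finset.sum_congr rfl fun e' _ => ?_
    have h1 : traceFst M e e' = (Matrix.of fun a a' => M (a, e) (a', e')).trace := rfl
    have h2 : traceFst (ampl Φ E M) e e'
      = (Φ (Matrix.of fun a a' => M (a, e) (a', e'))).trace := rfl
    rw [Matrix.sub_apply, Matrix.smul_apply, h1, h2, smul_eq_mul, Pi.star_apply]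
    ring

/-- A completely positive map which increases the trace of positive operators at most by a factor
`b > 0` is dominated by `b` times a channel. -/
theorem IsCP.exists_channel [Fintype A] [Fintype B] [Nonempty B]
    {Φ : Matrix A A ℂ →ₗ[ℂ] Matrix B B ℂ} (hΦ : IsCP Φ) {b : ℝ} (hb0 : 0 < b)
    (hb : ∀ M : Matrix A A ℂ, M.PosSemidef → (Φ M).trace ≤ b * M.trace) :
    ∃ F : Channel A B, IsCP ((b : ℂ) • F.map - Φ) := by
  classical
  obtain ⟨y⟩ := ‹Nonempty B›
  -- `f` measures the trace that `Φ` lacks compared with factor `b`; `G` puts it into a fixed pure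
  -- state, so that `Φ + G` multiplies traces by exactly `b`.
  let f : Matrix A A ℂ →ₗ[ℂ] ℂ :=
    (b : ℂ) • Matrix.traceLinearMap A ℂ ℂ - Matrix.traceLinearMap B ℂ ℂ ∘ₗ Φ
  let G : Matrix A A ℂ →ₗ[ℂ] Matrix B B ℂ := f.smulRight (Matrix.single y y 1)
  have hS : (Matrix.single y y (1 : ℂ)).PosSemidef := by
    rw [← Matrix.diagonal_single]
    refine Matrix.PosSemidef.diagonal fun i => ?_
    by_cases h : i = y
    · subst h; simp
    · simp [h]
  have hG : IsCP G := by
    intro E _ M hM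
    have h := hS.kronecker (trace_compl_posSemidef hΦ hb hM)
    have h' : ampl G E M = Matrix.single y y (1 : ℂ) ⊗ₖ
        ((b : ℂ) • traceFst M - traceFst (ampl Φ E M)) := by
      ext p q
      exact mul_comm _ _
    rw [h']
    exact h
  have hsum : IsCP ((b : ℂ)⁻¹ • (Φ + G)) := by
    intro E _ M hM
    have h := ((hΦ E M hM).add (hG E M hM)).smul
      (show (0 : ℂ) ≤ (b : ℂ)⁻¹ by
        rw [← Complex.ofReal_inv]; exact Complex.zero_le_real.2 (inv_nonneg.2 hb0.le))
    exact h
  have hbc : (b : ℂ) ≠ 0 := Complex.ofReal_ne_zero.2 hb0.ne'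
  refine ⟨⟨_, hsum, fun M => ?_⟩, ?_⟩
  · simp only [G, f, LinearMap.smul_apply, LinearMap.add_apply, LinearMap.smulRight_apply,
      Matrix.trace_smul, Matrix.trace_add, Matrix.trace_single_eq_same, LinearMap.sub_apply,
      LinearMap.comp_apply, Matrix.traceLinearMap_apply, smul_eq_mul]
    field_simp
    ring
  · convert hG using 1
    simp only
    rw [smul_inv_smul₀ hbc]
    abel

/-- Prepare an ancilla in the state `ρ`. -/
def Channel.append (A : Type) [Fintype A] [Fintype B] (ρ : DensityOp B) : Channel A (A × B) where
  map :=
    { toFun := fun M => M ⊗ₖ ρ.mat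
      map_add' := fun M N => Matrix.add_kronecker M N ρ.mat
      map_smul' := fun c M => Matrix.smul_kronecker c M ρ.mat }
  cp := fun E _ M hM => by
    have h := (hM.kronecker ρ.posSemidef).submatrix
      fun p : (A × B) × E => ((p.1.1, p.2), p.1.2)
    exact h
  tp M := by
    show (M ⊗ₖ ρ.mat).trace = _
    rw [Matrix.trace_kronecker, ρ.trace_eq_one, mul_one]

end Superoperators

set_option linter.unusedSectionVars false

/-! ### Joint strategies against a product of two tests. -/

section ProductTest

variable {X Y V X' Y' V' : Type} [Fintype X'] [Fintype Y'] [Fintype V']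
  [Fintype X] [Fintype Y] [Fintype V]

/-- The operation on `X` obtained from an operation `F` on `X × X'` by letting `X'` be a part of
the state `σ`, and testing the second output with `Z`. -/
def conditionalMap (F : Matrix (X × X') (X × X') ℂ →ₗ[ℂ] Matrix (Y × Y') (Y × Y') ℂ)
    (σ : Matrix (X' × V') (X' × V') ℂ) (Z : Channel (Y' × V') Bool) :
    Matrix X X ℂ →ₗ[ℂ] Matrix Y Y ℂ where
  toFun M := Matrix.of fun y z => Z.map ((ampl F V' ((M ⊗ₖ σ).submatrix
    (Equiv.prodAssoc X X' V') (Equiv.prodAssoc X X' V'))).submatrix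
      (fun p => ((y, p.1), p.2)) (fun p => ((z, p.1), p.2))) true true
  map_add' M N := by
    ext y z
    simp only [Matrix.add_kronecker, Matrix.submatrix_add, Pi.add_apply, map_add,
      Matrix.of_apply, Matrix.add_apply]
  map_smul' c M := by
    ext y z
    simp only [Matrix.smul_kronecker, Matrix.submatrix_smul, Pi.smul_apply, map_smul,
      Matrix.of_apply, Matrix.smul_apply, RingHom.id_apply]

variable {F : Matrix (X × X') (X × X') ℂ →ₗ[ℂ] Matrix (Y × Y') (Y × Y') ℂ}
  {σ : Matrix (X × V) (X × V) ℂ} {σ' : Matrix (X' × V') (X' × V') ℂ}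
  {Z : Channel (Y × V) Bool} {Z' : Channel (Y' × V') Bool}

theorem isCP_conditionalMap (hF : IsCP F) (hσ : σ'.PosSemidef) :
    IsCP (conditionalMap F σ' Z') := by
  intro E _ M hM
  have h1 := (hM.kronecker hσ).submatrix
    fun p : (X × X') × (V' × E) => ((p.1.1, p.2.2), (p.1.2, p.2.1))
  have h2 := (hF (V' × E) _ h1).submatrix
    fun p : (Y' × V') × (Y × E) => ((p.2.1, p.1.1), (p.1.2, p.2.2))
  have h3 := (Z'.cp (Y × E) _ h2).submatrix fun p : Y × E => (true, p)
  exact h3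

/-- The operation on `X'` obtained from `F` by preparing `X` in the state `M` and discarding the
first output. -/
def discardFst (F : Matrix (X × X') (X × X') ℂ →ₗ[ℂ] Matrix (Y × Y') (Y × Y') ℂ)
    (M : Matrix X X ℂ) : Matrix X' X' ℂ →ₗ[ℂ] Matrix Y' Y' ℂ where
  toFun N := traceFst (F (M ⊗ₖ N))
  map_add' N N' := by
    rw [Matrix.kronecker_add, map_add]
    ext y y'
    simp [traceFst, Finset.sum_add_distrib]
  map_smul' c N := by
    rw [Matrix.kronecker_smul, map_smul]
    ext y y'
    simp [traceFst, Finset.mul_sum]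

theorem isCP_discardFst (hF : IsCP F) {M : Matrix X X ℂ} (hM : M.PosSemidef) :
    IsCP (discardFst F M) := by
  intro E _ N hN
  have h1 := (hM.kronecker hN).submatrix fun p : (X × X') × E => (p.1.1, (p.1.2, p.2))
  have h2 := (hF E _ h1).submatrix fun p : Y × (Y' × E) => ((p.1, p.2.1), p.2.2)
  exact posSemidef_traceFst h2

/-- Discarding the first output commutes with testing the second one. This turns a trace bound into
a statement about strategies against `Z'` alone. -/
theorem trace_conditionalMap (M : Matrix X X ℂ) :
    (conditionalMap F σ' Z' M).trace = Z'.map (ampl (discardFst F M) V' σ') true true := by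
  have h : ampl (discardFst F M) V' σ' = ∑ y, (ampl F V' ((M ⊗ₖ σ').submatrix
    (Equiv.prodAssoc X X' V') (Equiv.prodAssoc X X' V'))).submatrix
      (fun p : Y' × V' => ((y, p.1), p.2)) (fun p => ((y, p.1), p.2)) := by
    ext p q
    rw [Matrix.sum_apply]
    rfl
  rw [h, map_sum, Matrix.sum_apply]
  rfl

theorem test_nonneg {F : Matrix X X ℂ →ₗ[ℂ] Matrix Y Y ℂ} (hF : IsCP F) (hσ : σ.PosSemidef) :
    0 ≤ Z.map (ampl F V σ) true true :=
  (Z.cp.posSemidef (hF V σ hσ)).diag_nonneg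

theorem trace_conditionalMap_le (F : Channel (X × X') (Y × Y')) (hσ : σ'.PosSemidef) {b : ℝ}
    (hb : ∀ G : Channel X' Y', (Z'.map (ampl G.map V' σ') true true).re ≤ b)
    {M : Matrix X X ℂ} (hM : M.PosSemidef) :
    (conditionalMap F.map σ' Z' M).trace ≤ b * M.trace := by
  obtain h0 | h0 := eq_or_ne M.trace 0
  · rw [hM.trace_eq_zero_iff.1 h0]
    simp
  have ht : 0 < M.trace := lt_of_le_of_ne hM.trace_nonneg h0.symm
  -- Adjoining `M` preserves traces only if `M` has trace one, hence the normalisation.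
  set M' := M.trace⁻¹ • M with hM'
  have hM'pos : M'.PosSemidef := hM.smul (inv_nonneg.2 ht.le)
  have htr : M'.trace = 1 := by
    rw [hM', Matrix.trace_smul, smul_eq_mul, inv_mul_cancel₀ h0]
  let G : Channel X' Y' :=
    { map := discardFst F.map M'
      cp := isCP_discardFst F.cp hM'pos
      tp := fun N => by
        show (traceFst (F.map (M' ⊗ₖ N))).trace = _
        rw [trace_traceFst, F.tp, Matrix.trace_kronecker, htr, one_mul] }
  have h1 : (conditionalMap F.map σ' Z' M').trace ≤ b := by
    rw [trace_conditionalMap]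
    have h2 : 0 ≤ Z'.map (ampl (discardFst F.map M') V' σ') true true :=
      test_nonneg G.cp hσ
    rw [Complex.le_def]
    exact ⟨hb G, by simpa using (Complex.le_def.1 h2).2.symm⟩
  have h3 : M = M.trace • M' := by rw [hM', smul_inv_smul₀ h0]
  calc (conditionalMap F.map σ' Z' M).trace
      = M.trace * (conditionalMap F.map σ' Z' M').trace := by
        conv_lhs => rw [h3, map_smul, Matrix.trace_smul, smul_eq_mul]
    _ ≤ M.trace * b := mul_le_mul_of_nonneg_left h1 ht.le
    _ = b * M.trace := mul_comm _ _

/-- Performing the second test before the first is how `tensorMap` is built, so this is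
definitional. -/
theorem tensorMap_test :
    tensorMap Z.map Z'.map ((ampl F (V × V') (regroup σ σ')).submatrix
      (Equiv.prodProdProdComm Y Y' V V').symm (Equiv.prodProdProdComm Y Y' V V').symm)
        (true, true) (true, true)
      = Z.map (ampl (conditionalMap F σ' Z') V σ) true true :=
  rfl

theorem re_product_test_le [Nonempty Y] [Nonempty Y'] (hσ : σ.PosSemidef) (hσ' : σ'.PosSemidef)
    {b b' : ℝ} (hb : ∀ G : Channel X Y, (Z.map (ampl G.map V σ) true true).re ≤ b)
    (hb' : ∀ G : Channel X' Y', (Z'.map (ampl G.map V' σ') true true).re ≤ b')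
    (F : Channel (X × X') (Y × Y')) :
    (tensorMap Z.map Z'.map ((ampl F.map (V × V') (regroup σ σ')).submatrix
      (Equiv.prodProdProdComm Y Y' V V').symm (Equiv.prodProdProdComm Y Y' V V').symm)
        (true, true) (true, true)).re ≤ b * b' := by
  classical
  -- A constant response is a channel, and its acceptance probability is nonnegative.
  have hb0 : 0 ≤ b' := by
    obtain ⟨y⟩ := ‹Nonempty Y'›
    let G : Channel X' Y' := Channel.ofFun fun _ => y
    exact (Complex.le_def.1 (test_nonneg (Z := Z') G.cp hσ')).1.trans (hb' G)
  rw [tensorMap_test]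
  -- The slack `b' < c` is needed because the dominating channel is obtained by dividing by `c`, and
  -- `b'` may be zero.
  have key : ∀ c : ℝ, b' < c →
      (Z.map (ampl (conditionalMap F.map σ' Z') V σ) true true).re ≤ b * c := by
    intro c hc
    have hc0 : 0 < c := hb0.trans_lt hc
    obtain ⟨G, hG⟩ := (isCP_conditionalMap (Z' := Z') F.cp hσ').exists_channel hc0
      fun M hM => trace_conditionalMap_le F hσ' (fun G => (hb' G).trans hc.le) hM
    have h1 := (Complex.le_def.1 (test_nonneg (Z := Z) hG hσ)).1
    have h2 : ampl ((c : ℂ) • G.map - conditionalMap F.map σ' Z') V σ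
        = (c : ℂ) • ampl G.map V σ - ampl (conditionalMap F.map σ' Z') V σ := rfl
    rw [h2, map_sub, map_smul, Matrix.sub_apply, Matrix.smul_apply, smul_eq_mul,
      Complex.sub_re, Complex.re_ofReal_mul, Complex.zero_re] at h1
    nlinarith [hb G]
  have hlim : Filter.Tendsto (fun c : ℝ => b * c) (nhdsWithin b' (Set.Ioi b')) (nhds (b * b')) :=
    ((continuous_const.mul continuous_id).tendsto b').mono_left nhdsWithin_le_nhds
  exact ge_of_tendsto hlim (Filter.eventually_of_mem self_mem_nhdsWithin key)

end ProductTest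

/-! ### Acceptance probabilities, completeness and soundness. -/

namespace VIS

variable {R : Type*}

/-- The witness of a concatenation given by a pair of witnesses. -/
abbrev pairWitness {V V' : VIS R} {r : R} (w : V.Witness r) (w' : V'.Witness r) :
    (V.concat V').Witness r :=
  (splitKeys (V.Key r) (V'.Key r)).symm (w, w')

theorem exists_pairWitness {V V' : VIS R} {r : R} (w : (V.concat V').Witness r) :
    ∃ (u : V.Witness r) (u' : V'.Witness r), w = pairWitness u u' :=
  ⟨_, _, ((splitKeys (V.Key r) (V'.Key r)).symm_apply_apply w).symm⟩

theorem prior_pairWitness {V V' : VIS R} {r : R} (w : V.Witness r) (w' : V'.Witness r) :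
    (V.concat V').prior r (pairWitness w w') = V.prior r w * V'.prior r w' :=
  rfl

theorem prior_pos_of_pairWitness {V V' : VIS R} {r : R} {w : V.Witness r} {w' : V'.Witness r}
    (h : 0 < (V.concat V').prior r (pairWitness w w')) :
    0 < V.prior r w ∧ 0 < V'.prior r w' := by
  rw [prior_pairWitness] at h
  have h1 := V.prior_nonneg r w
  have h2 := V'.prior_nonneg r w'
  exact ⟨h1.lt_of_ne fun h0 => by simp [← h0] at h, h2.lt_of_ne fun h0 => by simp [← h0] at h⟩

section Basic

variable (V : VIS R)

theorem nonempty_witness (r : R) : Nonempty (V.Witness r) := by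
  by_contra h
  rw [not_nonempty_iff] at h
  simpa using V.prior_sum r

theorem nonempty_X₀ (r : R) : Nonempty V.X₀ := by
  by_contra h
  rw [not_nonempty_iff] at h
  obtain ⟨w⟩ := V.nonempty_witness r
  have h1 := (V.Z₁ r).tp (V.pub r w).mat
  rw [(V.pub r w).trace_eq_one] at h1
  simp [Matrix.trace] at h1

/-- A trace-preserving map from a nonzero system cannot end in the zero system. Type 2 soundness
needs a default response. -/
theorem nonempty_Y₀ (r : R) : Nonempty V.Y₀ := by
  classical
  by_contra h
  rw [not_nonempty_iff] at h
  obtain ⟨w⟩ := V.nonempty_witness r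
  obtain ⟨x⟩ := V.nonempty_X₀ r
  have h1 := (V.Z₂ r w).tp (Matrix.single x x 1)
  rw [Matrix.trace_single_eq_same] at h1
  simp [Matrix.trace] at h1

variable (r : R)

theorem isCP_respond (w : V.Witness r) : IsCP (V.respond r w) := by
  intro E _ M hM
  exact posSemidef_traceFst (((V.Z₂ r w).cp E M hM).submatrix
    fun p : V.P₁ × (V.Y₀ × E) => ((p.1, p.2.1), p.2.2))

theorem trace_respond (w : V.Witness r) (M : Matrix V.X₀ V.X₀ ℂ) :
    (V.respond r w M).trace = M.trace :=
  (trace_traceFst _).trans ((V.Z₂ r w).tp M)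

/-- The state after the honest verifier's first step. -/
def honestChallenge (w : V.Witness r) : Matrix (V.X₀ × V.V₁) (V.X₀ × V.V₁) ℂ :=
  (V.Z₁ r).map (V.pub r w).mat

theorem posSemidef_honestChallenge (w : V.Witness r) : (V.honestChallenge r w).PosSemidef :=
  (V.Z₁ r).cp.posSemidef (V.pub r w).posSemidef

theorem trace_honestChallenge (w : V.Witness r) : (V.honestChallenge r w).trace = 1 :=
  ((V.Z₁ r).tp _).trans (V.pub r w).trace_eq_one

/-- The state after the honest verifier's first step, averaged over the witness. -/
def averageChallenge : Matrix (V.X₀ × V.V₁) (V.X₀ × V.V₁) ℂ :=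
  ∑ w, (V.prior r w : ℂ) • V.honestChallenge r w

theorem posSemidef_averageChallenge : (V.averageChallenge r).PosSemidef :=
  Matrix.posSemidef_sum _ fun w _ => (V.posSemidef_honestChallenge r w).smul
    (Complex.zero_le_real.2 (V.prior_nonneg r w))

/-- The strategy does not see the witness, so linearity moves the average onto the challenge and
type 2 soundness concerns one state only. -/
theorem sum_prior_mul_acceptProb (F : Matrix V.X₀ V.X₀ ℂ →ₗ[ℂ] Matrix V.Y₀ V.Y₀ ℂ) :
    ∑ w, V.prior r w * V.acceptProb r w F
      = ((V.Z₃ r).map (ampl F V.V₁ (V.averageChallenge r)) true true).re := by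
  simp only [averageChallenge, map_sum, map_smul, Matrix.sum_apply, Matrix.smul_apply,
    smul_eq_mul, Complex.re_sum, Complex.re_ofReal_mul]
  rfl

theorem acceptProb_nonneg (w : V.Witness r)
    {F : Matrix V.X₀ V.X₀ ℂ →ₗ[ℂ] Matrix V.Y₀ V.Y₀ ℂ} (hF : IsCP F) :
    0 ≤ V.acceptProb r w F :=
  (Complex.le_def.1 (test_nonneg hF (V.posSemidef_honestChallenge r w))).1

end Basic

section Concat

variable (V V' : VIS R) (r : R)

theorem honestChallenge_concat (w : V.Witness r) (w' : V'.Witness r) :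
    (V.concat V').honestChallenge r (pairWitness w w')
      = regroup (V.honestChallenge r w) (V'.honestChallenge r w') :=
  congrArg (fun M => M.submatrix (Equiv.prodProdProdComm V.X₀ V.V₁ V'.X₀ V'.V₁).symm
    (Equiv.prodProdProdComm V.X₀ V.V₁ V'.X₀ V'.V₁).symm)
      (tensorMap_kronecker (V.Z₁ r).map (V'.Z₁ r).map (V.pub r w).mat (V'.pub r w').mat)

/-- Independence of the two witnesses is what keeps the averaged state a product. -/
theorem averageChallenge_concat :
    (V.concat V').averageChallenge r
      = regroup (V.averageChallenge r) (V'.averageChallenge r) := by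
  have h : (V.concat V').averageChallenge r
      = ∑ w, ∑ w', (V.prior r w * V'.prior r w' : ℂ) •
        regroup (V.honestChallenge r w) (V'.honestChallenge r w') := by
    have h1 := (Equiv.sum_comp (splitKeys (V.Key r) (V'.Key r)).symm fun w =>
      ((V.concat V').prior r w : ℂ) • (V.concat V').honestChallenge r w).symm
    refine h1.trans ?_
    rw [Fintype.sum_prod_type]
    refine Finset.sum_congr rfl fun w _ => Finset.sum_congr rfl fun w' _ => ?_
    rw [honestChallenge_concat, prior_pairWitness, Complex.ofReal_mul]
    rfl
  rw [h]
  ext p q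
  simp only [averageChallenge, regroup, Matrix.sum_apply, Matrix.submatrix_apply,
    Matrix.smul_apply, Matrix.kroneckerMap_apply, smul_eq_mul, Finset.sum_mul_sum]
  refine Finset.sum_congr rfl fun w _ => Finset.sum_congr rfl fun w' _ => ?_
  ring

theorem Z₃_concat_apply (M : Matrix ((V.Y₀ × V'.Y₀) × (V.V₁ × V'.V₁))
      ((V.Y₀ × V'.Y₀) × (V.V₁ × V'.V₁)) ℂ) :
    ((V.concat V').Z₃ r).map M true true
      = tensorMap (V.Z₃ r).map (V'.Z₃ r).map (M.submatrix
        (Equiv.prodProdProdComm V.Y₀ V'.Y₀ V.V₁ V'.V₁).symm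
        (Equiv.prodProdProdComm V.Y₀ V'.Y₀ V.V₁ V'.V₁).symm) (true, true) (true, true) := by
  have h : ∀ N : Matrix (Bool × Bool) (Bool × Bool) ℂ,
      (Channel.ofFun fun x : Bool × Bool => x.1 && x.2).map N true true
        = N (true, true) (true, true) := by
    intro N
    simp [Channel.ofFun, Fintype.sum_prod_type]
  exact h _

theorem respond_concat_kronecker (w : V.Witness r) (w' : V'.Witness r)
    (M : Matrix V.X₀ V.X₀ ℂ) (N : Matrix V'.X₀ V'.X₀ ℂ) :
    (V.concat V').respond r (pairWitness w w') (M ⊗ₖ N)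
      = V.respond r w M ⊗ₖ V'.respond r w' N := by
  have h : (V.concat V').respond r (pairWitness w w') (M ⊗ₖ N)
      = traceFst ((tensorMap (V.Z₂ r w).map (V'.Z₂ r w').map (M ⊗ₖ N)).submatrix
        (Equiv.prodProdProdComm V.P₁ V.Y₀ V'.P₁ V'.Y₀).symm
        (Equiv.prodProdProdComm V.P₁ V.Y₀ V'.P₁ V'.Y₀).symm) := rfl
  rw [h, tensorMap_kronecker]
  exact traceFst_regroup _ _

theorem acceptProb_concat (w u : V.Witness r) (w' u' : V'.Witness r) :
    (V.concat V').acceptProb r (pairWitness w w')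
        ((V.concat V').respond r (pairWitness u u'))
      = V.acceptProb r w (V.respond r u) * V'.acceptProb r w' (V'.respond r u') := by
  have h : (V.concat V').acceptProb r (pairWitness w w')
        ((V.concat V').respond r (pairWitness u u'))
      = (((V.concat V').Z₃ r).map (ampl ((V.concat V').respond r (pairWitness u u'))
        (V.V₁ × V'.V₁) ((V.concat V').honestChallenge r (pairWitness w w'))) true true).re := rfl
  rw [h, honestChallenge_concat]
  have h1 := ampl_regroup (respond_concat_kronecker V V' r u u') (V.honestChallenge r w)
    (V'.honestChallenge r w')
  have h2 := (Z₃_concat_apply V V' r _).trans (congrArg (fun M => tensorMap (V.Z₃ r).map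
    (V'.Z₃ r).map (M.submatrix
        (Equiv.prodProdProdComm V.Y₀ V'.Y₀ V.V₁ V'.V₁).symm
        (Equiv.prodProdProdComm V.Y₀ V'.Y₀ V.V₁ V'.V₁).symm) (true, true) (true, true)) h1)
  have h3 := congrFun₂ (tensorMap_kronecker (V.Z₃ r).map (V'.Z₃ r).map
    (ampl (V.respond r u) V.V₁ (V.honestChallenge r w))
    (ampl (V'.respond r u') V'.V₁ (V'.honestChallenge r w'))) (true, true) (true, true)
  have h4 := congrArg Complex.re (h2.trans h3)
  refine h4.trans ?_
  -- The real part of the product splits because the first factor is nonnegative, hence real.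
  have h5 := test_nonneg (Z := V.Z₃ r) (V.isCP_respond r u) (V.posSemidef_honestChallenge r w)
  rw [Matrix.kroneckerMap_apply, Complex.mul_re, ← (Complex.le_def.1 h5).2]
  simp
  rfl

variable {V V'}

theorem Complete.concat {α α' : ℝ} (hα : 0 ≤ α) (hα' : 0 ≤ α') (h : V.Complete α)
    (h' : V'.Complete α') : (V.concat V').Complete (α * α') := by
  intro r w hw
  obtain ⟨u, u', rfl⟩ := exists_pairWitness w
  obtain ⟨hu, hu'⟩ := prior_pos_of_pairWitness hw
  rw [acceptProb_concat]
  exact mul_le_mul (h r u hu) (h' r u' hu') hα' (hα.trans (h r u hu))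

theorem SoundType1.concat {β β' : ℝ} (h : V.SoundType1 β)
    (h' : V'.SoundType1 β') : (V.concat V').SoundType1 (β * β') := by
  intro r w v hw hv
  obtain ⟨u, u', rfl⟩ := exists_pairWitness w
  obtain ⟨x, x', rfl⟩ := exists_pairWitness v
  obtain ⟨hu, hu'⟩ := prior_pos_of_pairWitness hw
  rw [acceptProb_concat]
  -- Incorrectness in a concatenation is required of every key, so both halves are incorrect.
  have h1 := h r u x hu fun k => hv (.inl k)
  exact mul_le_mul h1 (h' r u' x' hu' fun k => hv (.inr k))
    (V'.acceptProb_nonneg r u' (V'.isCP_respond r x'))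
    ((V.acceptProb_nonneg r u (V.isCP_respond r x)).trans h1)

theorem SoundType2.concat {β β' : ℝ} (h : V.SoundType2 β)
    (h' : V'.SoundType2 β') : (V.concat V').SoundType2 (β * β') := by
  intro r F
  have := V.nonempty_Y₀ r
  have := V'.nonempty_Y₀ r
  rw [sum_prior_mul_acceptProb, averageChallenge_concat]
  refine (congrArg Complex.re (Z₃_concat_apply V V' r _)).trans_le ?_
  exact re_product_test_le (V.posSemidef_averageChallenge r) (V'.posSemidef_averageChallenge r)
    (fun G => (V.sum_prior_mul_acceptProb r G.map).symm.trans_le (h r G))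
    (fun G => (V'.sum_prior_mul_acceptProb r G.map).symm.trans_le (h' r G)) F

end Concat

end VIS

/-! ### Tensor products of superoperators, one factor at a time. -/

section TensorMap

variable {A B A' B' S : Type} {Φ Φ₁ : Matrix A A ℂ →ₗ[ℂ] Matrix B B ℂ}
  {Ψ Ψ₁ : Matrix A' A' ℂ →ₗ[ℂ] Matrix B' B' ℂ}

/-- Products of matrix units are the matrix units of the product, so product operators span. -/
theorem eq_tensorMap [Finite A] [Finite A']
    {Θ : Matrix (A × A') (A × A') ℂ →ₗ[ℂ] Matrix (B × B') (B × B') ℂ}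
    (h : ∀ M N, Θ (M ⊗ₖ N) = Φ M ⊗ₖ Ψ N) : Θ = tensorMap Φ Ψ := by
  classical
  apply Matrix.ext_linearMap
  intro i j
  apply LinearMap.ext_ring
  show Θ (Matrix.single i j 1) = tensorMap Φ Ψ (Matrix.single i j 1)
  have h1 : Matrix.single i j (1 : ℂ)
      = Matrix.single i.1 j.1 (1 : ℂ) ⊗ₖ Matrix.single i.2 j.2 (1 : ℂ) := by
    rw [Matrix.single_kronecker_single, mul_one]
  rw [h1, h, tensorMap_kronecker]

/-- Superoperators acting on different tensor factors commute. -/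
theorem tensorMap_comm [Finite A] [Finite A'] (M : Matrix (A × A') (A × A') ℂ) (p q : B × B') :
    tensorMap Φ Ψ M p q = tensorMap Ψ Φ (M.submatrix Prod.swap Prod.swap) p.swap q.swap := by
  let L : Matrix (A × A') (A × A') ℂ →ₗ[ℂ] Matrix (B × B') (B × B') ℂ :=
    { toFun := fun M => (tensorMap Ψ Φ (M.submatrix Prod.swap Prod.swap)).submatrix
        Prod.swap Prod.swap
      map_add' := fun M N => by
        rw [Matrix.submatrix_add, Pi.add_apply, Pi.add_apply, map_add, Matrix.submatrix_add]; rfl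
      map_smul' := fun c M => by
        rw [Matrix.submatrix_smul, Pi.smul_apply, Pi.smul_apply, map_smul,
          Matrix.submatrix_smul]; rfl }
  have h : L = tensorMap Φ Ψ := by
    refine eq_tensorMap fun M N => ?_
    have h2 : (M ⊗ₖ N).submatrix Prod.swap Prod.swap = N ⊗ₖ M := by
      ext a b; simp [mul_comm]
    show (tensorMap Ψ Φ ((M ⊗ₖ N).submatrix Prod.swap Prod.swap)).submatrix
      Prod.swap Prod.swap = _
    rw [h2, tensorMap_kronecker]
    ext a b
    simp [mul_comm]
  exact (congrFun₂ (LinearMap.congr_fun h M) p q).symm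

/-- States that agree once `Φ` or `Φ₁` has acted still agree after `Ψ`. Since `tensorMap` applies
its second factor first, `tensorMap_comm` is needed to reverse the order. -/
theorem ampl_tensorMap_congr_left [Finite A] [Finite A']
    {C C₁ : Matrix ((A × A') × S) ((A × A') × S) ℂ}
    (h : ampl Φ (A' × S) (C.submatrix (Equiv.prodAssoc A A' S).symm (Equiv.prodAssoc A A' S).symm)
      = ampl Φ₁ (A' × S)
        (C₁.submatrix (Equiv.prodAssoc A A' S).symm (Equiv.prodAssoc A A' S).symm)) :
    ampl (tensorMap Φ Ψ) S C = ampl (tensorMap Φ₁ Ψ) S C₁ := by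
  ext ⟨p, s⟩ ⟨q, t⟩
  refine (tensorMap_comm _ _ _).trans (Eq.trans ?_ (tensorMap_comm _ _ _).symm)
  refine congrFun₂ (congrArg Ψ ?_) p.2 q.2
  ext a b
  exact congrFun₂ h (p.1, (a, s)) (q.1, (b, t))

/-- Regrouping of three systems. -/
abbrev assocSwap (A A' S : Type) : (A × A') × S ≃ A' × (A × S) :=
  ((Equiv.prodComm A A').prodCongr (Equiv.refl S)).trans (Equiv.prodAssoc A' A S)

theorem ampl_tensorMap_congr_right
    {C C₁ : Matrix ((A × A') × S) ((A × A') × S) ℂ}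
    (h : ampl Ψ (A × S) (C.submatrix (assocSwap A A' S).symm (assocSwap A A' S).symm)
      = ampl Ψ₁ (A × S) (C₁.submatrix (assocSwap A A' S).symm (assocSwap A A' S).symm)) :
    ampl (tensorMap Φ Ψ) S C = ampl (tensorMap Φ Ψ₁) S C₁ := by
  ext ⟨p, s⟩ ⟨q, t⟩
  refine congrFun₂ (congrArg Φ ?_) p.1 q.1
  ext a b
  exact congrFun₂ h (p.2, (a, s)) (q.2, (b, t))

theorem sum_tensorMap_snd [Fintype A'] [Fintype B'] (hΨ : ∀ N, (Ψ N).trace = N.trace)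
    (M : Matrix (A × A') (A × A') ℂ) (b : B) :
    ∑ b', tensorMap Φ Ψ M (b, b') (b, b') = Φ (traceSnd M) b b := by
  have h : traceSnd M
      = ∑ b', Matrix.of fun a a' => Ψ (Matrix.of fun c c' => M (a, c) (a', c')) b' b' := by
    ext a a'
    rw [Matrix.sum_apply]
    exact (hΨ (Matrix.of fun c c' => M (a, c) (a', c'))).symm
  rw [h, map_sum, Matrix.sum_apply]
  rfl

theorem sum_tensorMap_fst [Fintype A] [Finite A'] [Fintype B] (hΦ : ∀ N, (Φ N).trace = N.trace)
    (M : Matrix (A × A') (A × A') ℂ) (b' : B') :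
    ∑ b, tensorMap Φ Ψ M (b, b') (b, b') = Ψ (traceFst M) b' b' := by
  rw [Finset.sum_congr rfl fun b _ => tensorMap_comm (Φ := Φ) (Ψ := Ψ) M (b, b') (b, b')]
  exact sum_tensorMap_snd hΦ (M.submatrix Prod.swap Prod.swap) b'

end TensorMap

/-! ### Zero knowledge: hybrids, speciousness and honest views. -/

namespace VIS

variable {R : Type*}

namespace Verifier

section Basic

variable {V : VIS R} {r : R} (A : V.Verifier r)

theorem view₂_eq (w : V.Witness r) :
    A.view₂ w = ampl (V.respond r w) A.S₁ (A.challenge w) :=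
  rfl

/-- Tracing out the verifier's register commutes with the prover's step, so the memory depends on
the verifier only through the received challenge. -/
theorem proverMemory_eq (w : V.Witness r) (p : V.P₁) :
    A.proverMemory w p = (∑ y, (V.Z₂ r w).map (A.proverState w) (p, y) (p, y)).re := by
  have h : A.proverState w
      = ∑ s, Matrix.of fun x x' => A.challenge w (x, s) (x', s) := by
    ext x x'
    rw [Matrix.sum_apply]
    rfl
  rw [h, map_sum]
  simp only [Matrix.sum_apply]
  rfl

variable {A} in
-- The final view is a fixed channel applied to the second view.
theorem learnsNothing_of (h : ∀ w w', 0 < V.prior r w → 0 < V.prior r w' →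
    A.view₁ w = A.view₁ w' ∧ A.view₂ w = A.view₂ w') : A.LearnsNothing :=
  fun w w' hw hw' => ⟨(h w w' hw hw').1, (h w w' hw hw').2,
    congrArg A.A₃.map (h w w' hw hw').2⟩

end Basic

section Concat

variable {V V' : VIS R} {r : R}

theorem respond_concat (w : V.Witness r) (w' : V'.Witness r) :
    (V.concat V').respond r (pairWitness w w')
      = tensorMap (V.respond r w) (V'.respond r w') :=
  eq_tensorMap (respond_concat_kronecker V V' r w w')

variable (A : (V.concat V').Verifier r)

/-- The first operation of a verifier of a concatenation, as an operation on the pair of the public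
systems. -/
def firstOp : Channel (V.H r × V'.H r) ((V.X₀ × V'.X₀) × A.S₁) := A.A₁

/-- The verifier for the first protocol that prepares the public system of the second protocol with
the witness `w'`, and runs the first step of `A`. -/
def left (w' : V'.Witness r) : V.Verifier r where
  S₁ := V'.X₀ × A.S₁
  S₂ := Unit
  A₁ := ((Channel.append (V.H r) (V'.pub r w')).andThen A.firstOp).reindex (Equiv.refl _)
    (Equiv.prodAssoc V.X₀ V'.X₀ A.S₁)
  A₃ := Channel.ofFun fun _ => ()

/-- The verifier for the second protocol that prepares the public system of the first protocol with
the witness `w`, and runs the first step of `A`. -/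
def right (w : V.Witness r) : V'.Verifier r where
  S₁ := V.X₀ × A.S₁
  S₂ := Unit
  A₁ := (((Channel.append (V'.H r) (V.pub r w)).reindex (Equiv.refl _)
    (Equiv.prodComm _ _)).andThen A.firstOp).reindex (Equiv.refl _) (assocSwap V.X₀ V'.X₀ A.S₁)
  A₃ := Channel.ofFun fun _ => ()

/-- The joint state after the first step of a verifier of a concatenation. -/
def pairChallenge (w : V.Witness r) (w' : V'.Witness r) :
    Matrix ((V.X₀ × V'.X₀) × A.S₁) ((V.X₀ × V'.X₀) × A.S₁) ℂ :=
  A.challenge (pairWitness w w')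

theorem challenge_right (w : V.Witness r) (w' : V'.Witness r) :
    (A.right w).challenge w' = (A.pairChallenge w w').submatrix
      (assocSwap V.X₀ V'.X₀ A.S₁).symm (assocSwap V.X₀ V'.X₀ A.S₁).symm := by
  have h : ((V'.pub r w').mat ⊗ₖ (V.pub r w).mat).submatrix (Equiv.prodComm _ _).symm
      (Equiv.prodComm _ _).symm = (V.pub r w).mat ⊗ₖ (V'.pub r w').mat := by
    ext p q
    exact mul_comm _ _
  exact congrArg (fun M => (A.firstOp.map M).submatrix (assocSwap V.X₀ V'.X₀ A.S₁).symm
    (assocSwap V.X₀ V'.X₀ A.S₁).symm) h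

theorem view₁_eq_traceFst_left (w : V.Witness r) (w' : V'.Witness r) :
    A.view₁ (pairWitness w w') = traceFst ((A.left w').view₁ w) := by
  ext s t
  exact Fintype.sum_prod_type_right fun x : V.X₀ × V'.X₀ => A.pairChallenge w w' (x, s) (x, t)

theorem view₁_eq_traceFst_right (w : V.Witness r) (w' : V'.Witness r) :
    A.view₁ (pairWitness w w') = traceFst ((A.right w).view₁ w') := by
  have h : (A.right w).view₁ w' = traceFst ((A.right w).challenge w') := rfl
  rw [h, challenge_right]
  ext s t
  exact Fintype.sum_prod_type fun x : V.X₀ × V'.X₀ => A.pairChallenge w w' (x, s) (x, t)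

theorem view₂_pairWitness (w : V.Witness r) (w' : V'.Witness r) :
    A.view₂ (pairWitness w w')
      = ampl (tensorMap (V.respond r w) (V'.respond r w')) A.S₁ (A.pairChallenge w w') :=
  congrArg (fun Θ => ampl Θ A.S₁ (A.pairChallenge w w')) (respond_concat w w')

/-- After the first response `left w'` still stores the second challenge; answering it with `w'`
yields the view of `A`. -/
theorem view₂_congr_left {w u : V.Witness r} {w' : V'.Witness r}
    (h : (A.left w').view₂ w = (A.left w').view₂ u) :
    A.view₂ (pairWitness w w') = A.view₂ (pairWitness u w') := by
  rw [view₂_pairWitness, view₂_pairWitness]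
  exact ampl_tensorMap_congr_left h

theorem view₂_congr_right {w : V.Witness r} {w' u' : V'.Witness r}
    (h : (A.right w).view₂ w' = (A.right w).view₂ u') :
    A.view₂ (pairWitness w w') = A.view₂ (pairWitness w u') := by
  rw [view₂_pairWitness, view₂_pairWitness]
  rw [view₂_eq, view₂_eq, challenge_right, challenge_right] at h
  exact ampl_tensorMap_congr_right h

variable {A} in
-- The hybrid path is `(w, w')`, `(u, w')`, `(u, u')`. Only `w'` and `u` are held fixed along it,
-- and both have positive probability.
theorem learnsNothing_of_left_right
    (hl : ∀ w', 0 < V'.prior r w' → (A.left w').LearnsNothing)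
    (hr : ∀ w, 0 < V.prior r w → (A.right w).LearnsNothing) : A.LearnsNothing := by
  refine learnsNothing_of fun w u hw hu => ?_
  obtain ⟨w, w', rfl⟩ := exists_pairWitness w
  obtain ⟨u, u', rfl⟩ := exists_pairWitness u
  obtain ⟨hw, hw'⟩ := prior_pos_of_pairWitness hw
  obtain ⟨hu, hu'⟩ := prior_pos_of_pairWitness hu
  obtain ⟨h1, h2, -⟩ := hl w' hw' w u hw hu
  obtain ⟨h3, h4, -⟩ := hr u hu w' u' hw' hu'
  constructor
  · rw [view₁_eq_traceFst_left, h1, ← view₁_eq_traceFst_left, view₁_eq_traceFst_right, h3,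
      ← view₁_eq_traceFst_right]
  · rw [A.view₂_congr_left h2, A.view₂_congr_right h4]

/-- The challenge received by the prover of a concatenation. -/
def pairProverState (w : V.Witness r) (w' : V'.Witness r) :
    Matrix (V.X₀ × V'.X₀) (V.X₀ × V'.X₀) ℂ :=
  A.proverState (pairWitness w w')

theorem proverState_left (w : V.Witness r) (w' : V'.Witness r) :
    (A.left w').proverState w = traceSnd (A.pairProverState w w') := by
  ext x y
  exact Fintype.sum_prod_type fun p : V'.X₀ × A.S₁ =>
    A.pairChallenge w w' ((x, p.1), p.2) ((y, p.1), p.2)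

theorem proverState_right (w : V.Witness r) (w' : V'.Witness r) :
    (A.right w).proverState w' = traceFst (A.pairProverState w w') := by
  have h : (A.right w).proverState w' = traceSnd ((A.right w).challenge w') := rfl
  rw [h, challenge_right]
  ext x y
  exact Fintype.sum_prod_type fun p : V.X₀ × A.S₁ =>
    A.pairChallenge w w' ((p.1, x), p.2) ((p.1, y), p.2)

theorem pairProverState_honestVerifier (w : V.Witness r) (w' : V'.Witness r) :
    ((V.concat V').honestVerifier r).pairProverState w w'
      = (V.honestVerifier r).proverState w ⊗ₖ (V'.honestVerifier r).proverState w' :=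
  (congrArg (fun M : Matrix ((V.X₀ × V'.X₀) × (V.V₁ × V'.V₁)) _ ℂ => traceSnd M)
    (honestChallenge_concat V V' r w w')).trans (traceSnd_regroup _ _)

theorem trace_proverState_honestVerifier (w : V.Witness r) :
    ((V.honestVerifier r).proverState w).trace = 1 :=
  (trace_traceSnd _).trans (V.trace_honestChallenge r w)

/-- The second prover's step preserves traces, so forgetting all of its output leaves the first step
applied to the marginal challenge. -/
theorem sum_proverMemory_snd (w : V.Witness r) (w' : V'.Witness r) (p : V.P₁) :
    ∑ p' : V'.P₁, A.proverMemory (pairWitness w w') (p, p')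
      = (∑ y, (V.Z₂ r w).map (traceSnd (A.pairProverState w w')) (p, y) (p, y)).re := by
  have h : ∀ p' : V'.P₁, A.proverMemory (pairWitness w w') (p, p')
      = (∑ y : V.Y₀ × V'.Y₀, tensorMap (V.Z₂ r w).map (V'.Z₂ r w').map
        (A.pairProverState w w') ((p, y.1), (p', y.2)) ((p, y.1), (p', y.2))).re :=
    fun p' => A.proverMemory_eq (pairWitness w w') (p, p')
  simp only [h, ← Complex.re_sum, ← sum_tensorMap_snd (V'.Z₂ r w').tp, Fintype.sum_prod_type]
  rw [Finset.sum_comm]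

theorem sum_proverMemory_fst (w : V.Witness r) (w' : V'.Witness r) (p' : V'.P₁) :
    ∑ p : V.P₁, A.proverMemory (pairWitness w w') (p, p')
      = (∑ y, (V'.Z₂ r w').map (traceFst (A.pairProverState w w')) (p', y) (p', y)).re := by
  have h : ∀ p : V.P₁, A.proverMemory (pairWitness w w') (p, p')
      = (∑ y : V.Y₀ × V'.Y₀, tensorMap (V.Z₂ r w).map (V'.Z₂ r w').map
        (A.pairProverState w w') ((p, y.1), (p', y.2)) ((p, y.1), (p', y.2))).re :=
    fun p => A.proverMemory_eq (pairWitness w w') (p, p')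
  simp only [h, ← Complex.re_sum, ← sum_tensorMap_fst (V.Z₂ r w).tp,
    Fintype.sum_prod_type_right]
  rw [Finset.sum_comm]
  exact congrArg Complex.re (Finset.sum_congr rfl fun _ _ => Finset.sum_comm)

theorem traceSnd_pairProverState_honestVerifier (w : V.Witness r) (w' : V'.Witness r) :
    traceSnd (((V.concat V').honestVerifier r).pairProverState w w')
      = (V.honestVerifier r).proverState w := by
  rw [pairProverState_honestVerifier, traceSnd_kronecker, trace_proverState_honestVerifier,
    one_smul]

theorem traceFst_pairProverState_honestVerifier (w : V.Witness r) (w' : V'.Witness r) :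
    traceFst (((V.concat V').honestVerifier r).pairProverState w w')
      = (V'.honestVerifier r).proverState w' := by
  rw [pairProverState_honestVerifier, traceFst_kronecker, trace_proverState_honestVerifier,
    one_smul]

theorem prior_pairWitness_pos {w : V.Witness r} {w' : V'.Witness r} (h : 0 < V.prior r w)
    (h' : 0 < V'.prior r w') : 0 < (V.concat V').prior r (pairWitness w w') :=
  mul_pos h h'

variable {A}

theorem QuantumSpecious.left (hA : A.QuantumSpecious) {w' : V'.Witness r}
    (hw' : 0 < V'.prior r w') : (A.left w').QuantumSpecious := by
  intro w hw
  rw [proverState_left, ← traceSnd_pairProverState_honestVerifier w w']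
  exact congrArg (fun M : Matrix (V.X₀ × V'.X₀) (V.X₀ × V'.X₀) ℂ => traceSnd M)
    (hA _ (prior_pairWitness_pos hw hw'))

theorem QuantumSpecious.right (hA : A.QuantumSpecious) {w : V.Witness r}
    (hw : 0 < V.prior r w) : (A.right w).QuantumSpecious := by
  intro w' hw'
  rw [proverState_right, ← traceFst_pairProverState_honestVerifier w w']
  exact congrArg (fun M : Matrix (V.X₀ × V'.X₀) (V.X₀ × V'.X₀) ℂ => traceFst M)
    (hA _ (prior_pairWitness_pos hw hw'))

/-- Equal joint memory distributions have equal marginals, and a marginal is the memory of the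
single protocol. -/
theorem ClassicalSpecious.left (hA : A.ClassicalSpecious) {w' : V'.Witness r}
    (hw' : 0 < V'.prior r w') : (A.left w').ClassicalSpecious := by
  intro w hw
  ext p
  rw [proverMemory_eq, proverMemory_eq, proverState_left,
    ← traceSnd_pairProverState_honestVerifier w w', ← sum_proverMemory_snd,
    ← sum_proverMemory_snd, hA _ (prior_pairWitness_pos hw hw')]

theorem ClassicalSpecious.right (hA : A.ClassicalSpecious) {w : V.Witness r}
    (hw : 0 < V.prior r w) : (A.right w).ClassicalSpecious := by
  intro w' hw'
  ext p'
  rw [proverMemory_eq, proverMemory_eq, proverState_right,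
    ← traceFst_pairProverState_honestVerifier w w', ← sum_proverMemory_fst,
    ← sum_proverMemory_fst, hA _ (prior_pairWitness_pos hw hw')]

/-- The hybrids `left w'` and `right w` are not the honest verifiers of the factors, so the views
are factored directly instead. -/
theorem LearnsNothing.honestVerifier_concat (h : (V.honestVerifier r).LearnsNothing)
    (h' : (V'.honestVerifier r).LearnsNothing) :
    ((V.concat V').honestVerifier r).LearnsNothing := by
  have e1 : ∀ (w : V.Witness r) (w' : V'.Witness r),
      ((V.concat V').honestVerifier r).view₁ (pairWitness w w')
        = (V.honestVerifier r).view₁ w ⊗ₖ (V'.honestVerifier r).view₁ w' := fun w w' =>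
    (congrArg (fun M : Matrix ((V.X₀ × V'.X₀) × (V.V₁ × V'.V₁)) _ ℂ => traceFst M)
      (honestChallenge_concat V V' r w w')).trans (traceFst_regroup _ _)
  have e2 : ∀ (w : V.Witness r) (w' : V'.Witness r),
      ((V.concat V').honestVerifier r).view₂ (pairWitness w w')
        = regroup ((V.honestVerifier r).view₂ w) ((V'.honestVerifier r).view₂ w') :=
    fun w w' => (congrArg (ampl ((V.concat V').respond r (pairWitness w w')) (V.V₁ × V'.V₁))
      (honestChallenge_concat V V' r w w')).trans
        (ampl_regroup (respond_concat_kronecker V V' r w w') _ _)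
  refine learnsNothing_of fun w u hw hu => ?_
  obtain ⟨w, w', rfl⟩ := exists_pairWitness w
  obtain ⟨u, u', rfl⟩ := exists_pairWitness u
  obtain ⟨hw, hw'⟩ := prior_pos_of_pairWitness hw
  obtain ⟨hu, hu'⟩ := prior_pos_of_pairWitness hu
  obtain ⟨h1, h2, -⟩ := h w u hw hu
  obtain ⟨h3, h4, -⟩ := h' w' u' hw' hu'
  exact ⟨by rw [e1, e1, h1, h3], by rw [e2, e2, h2, h4]⟩

end Concat

end Verifier

theorem ZeroKnowledge.concat {V V' : VIS R} {t : VerifierType} (h : V.ZeroKnowledge t)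
    (h' : V'.ZeroKnowledge t) : (V.concat V').ZeroKnowledge t := by
  cases t with
  | HV => exact fun r => (h r).honestVerifier_concat (h' r)
  | QSV =>
    exact fun r A hA => Verifier.learnsNothing_of_left_right
      (fun _ hw' => h r _ (hA.left hw')) (fun _ hw => h' r _ (hA.right hw))
  | CSV =>
    exact fun r A hA => Verifier.learnsNothing_of_left_right
      (fun _ hw' => h r _ (hA.left hw')) (fun _ hw => h' r _ (hA.right hw))
  | DV =>
    exact fun r A => Verifier.learnsNothing_of_left_right
      (fun _ _ => h r _) (fun _ _ => h' r _)

/-! ### Assembly, the trivial protocol and powers. -/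

theorem IsQZKP.concat {V V' : VIS R} {t : VerifierType} {α β α' β' : ℝ} (hα : 0 ≤ α)
    (hα' : 0 ≤ α') (h : V.IsQZKP t α β) (h' : V'.IsQZKP t α' β') :
    (V.concat V').IsQZKP t (α * α') (β * β') :=
  ⟨h.1.concat hα hα' h'.1, h.2.1.concat h'.2.1, h.2.2.1.concat h'.2.2.1, h.2.2.2.concat h'.2.2.2⟩

theorem acceptProb_trivial (r : R) (w : (trivial : VIS R).Witness r)
    {F : Matrix Unit Unit ℂ →ₗ[ℂ] Matrix Unit Unit ℂ} (hF : ∀ M, (F M).trace = M.trace) :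
    (trivial : VIS R).acceptProb r w F = 1 := by
  have h : (trivial : VIS R).acceptProb r w F
      = ((Channel.ofFun fun _ : Unit × Unit => true).map
        (ampl F Unit ((trivial : VIS R).honestChallenge r w)) true true).re := rfl
  have h1 : ∀ M : Matrix (Unit × Unit) (Unit × Unit) ℂ,
      (Channel.ofFun fun _ : Unit × Unit => true).map M true true = M.trace := by
    intro M
    simp [Channel.ofFun, Matrix.trace]
  have h2 := (trace_ampl hF _).trans ((trivial : VIS R).trace_honestChallenge r w)
  rw [h, h1]
  exact (congrArg Complex.re h2).trans Complex.one_re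

theorem isQZKP_trivial (t : VerifierType) : (trivial : VIS R).IsQZKP t 1 1 := by
  have hL : ∀ r (A : (trivial : VIS R).Verifier r), A.LearnsNothing := by
    intro r A w w' _ _
    -- The trivial protocol has a single witness, so there is nothing to learn.
    have : w = w' := funext fun _ => rfl
    rw [this]
    exact ⟨rfl, rfl, rfl⟩
  refine ⟨fun r w _ => ?_, fun r w w' _ _ => ?_, fun r F => ?_, ?_⟩
  · exact (acceptProb_trivial r w (trace_respond _ r w)).ge
  · exact (acceptProb_trivial r w (trace_respond _ r w')).le
  · rw [Finset.sum_congr rfl fun w _ => by rw [acceptProb_trivial r w F.tp, mul_one]]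
    exact ((trivial : VIS R).prior_sum r).le
  · cases t with
    | HV => exact fun r => hL r _
    | QSV => exact fun r A _ => hL r A
    | CSV => exact fun r A _ => hL r A
    | DV => exact hL

theorem IsQZKP.pow {V : VIS R} {t : VerifierType} {α β : ℝ} (hα : 0 ≤ α)
    (h : V.IsQZKP t α β) : ∀ l : ℕ, (V.pow l).IsQZKP t (α ^ l) (β ^ l)
  | 0 => by simpa only [_root_.pow_zero, VIS.pow] using isQZKP_trivial t
  | 1 => by simpa only [_root_.pow_one, VIS.pow] using h
  -- `VIS.pow` has base cases `0` and `1`, so the first genuine concatenation is at exponent two.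
  | l + 2 => by
    rw [_root_.pow_succ α, _root_.pow_succ β]
    exact (IsQZKP.pow hα h (l + 1)).concat (pow_nonneg hα _) hα h

end VIS

end QVIS

theorem theorem1 {R : Type*} (t : QVIS.VerifierType) :
    (∀ (V₁ V₂ : QVIS.VIS R) (α₁ β₁ α₂ β₂ : ℝ), 0 ≤ α₁ → 0 ≤ α₂ →
      V₁.IsQZKP t α₁ β₁ → V₂.IsQZKP t α₂ β₂ →
        (V₁.concat V₂).IsQZKP t (α₁ * α₂) (β₁ * β₂)) ∧
    (∀ (V : QVIS.VIS R) (α β : ℝ), 0 ≤ α → V.IsQZKP t α β →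
      ∀ l : ℕ, (V.pow l).IsQZKP t (α ^ l) (β ^ l)) :=
  ⟨fun _ _ _ _ _ _ hα₁ hα₂ h₁ h₂ => h₁.concat hα₁ hα₂ h₂, fun _ _ _ hα h => h.pow hα⟩
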